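/- Let $n\ge 1$, $k\ge 0$, and let $\mathbf 1=(1,\dots,1)\in\mathbb R^n$. Let $P$ be a homogeneous real polynomial of degree $k$ in $n$ variables that is symmetric (invariant under all permutations of the coordinates) and hyperbolic with respect to $\mathbf 1$, that is, $P(\mathbf 1)>0$ and for every $x\in\mathbb R^n$ all complex zeros of the univariate polynomial $t\mapsto P(t\mathbf 1+x)$ are real. Let $\Gamma(P)$ be the hyperbolicity cone of $P$, that is, the set of $x\in\mathbb R^n$ such that every $\mu_i(x)$ in the factorization $P(t\mathbf 1+x)=P(\mathbf 1)\prod_{i=1}^k (t+\mu_i(x))$ is positive. Let $A$ be a real symmetric $n\times n$ matrix, let $\lambda(A)\in\mathbb R^n$ be the vector of its eigenvalues, listed with multiplicity (the order does not matter, since $P$ is symmetric), and suppose that $\lambda(A)\in\Gamma(P)$. For a matrix $B$ let $\operatorname{diag}(B)\in\mathbb R^n$ be the vector of its diagonal entries. Then for every orthogonal $n\times n$ matrix $U$, $$P(\lambda(A))\ \le\ P(\operatorname{diag}(UAU^{\top}))\ \le\ P\!\left(\frac{\operatorname{tr}A}{n}\,\mathbf 1\right).$$ Moreover, the left inequality is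 attained when $U$ diagonalizes $A$: for every orthogonal $U$ such that $UAU^{\top}$ is a diagonal matrix, $P(\operatorname{diag}(UAU^{\top}))=P(\lambda(A))$, and such a $U$ exists. -/

import Mathlib

open Matrix

noncomputable section

/-- The univariate real polynomial `t ↦ P(t a + x)`. -/
def linePoly {n : ℕ} (P : MvPolynomial (Fin n) ℝ) (a x : Fin n → ℝ) : Polynomial ℝ :=
  MvPolynomial.aeval (fun i => Polynomial.C (a i) * Polynomial.X + Polynomial.C (x i)) P

/-- `P` is a homogeneous real polynomial of degree `k` on `ℝⁿ`, hyperbolic with respect to `a`: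
`P(a) > 0`, and for every real `x` all complex zeros of `t ↦ P(t a + x)` are real. -/
structure IsHyperbolicWrt {n : ℕ} (k : ℕ) (P : MvPolynomial (Fin n) ℝ) (a : Fin n → ℝ) :
    Prop where
  isHomogeneous : P.IsHomogeneous k
  eval_pos : 0 < MvPolynomial.eval a P
  zeros_real : ∀ (x : Fin n → ℝ) (z : ℂ), Polynomial.aeval z (linePoly P a x) = 0 → z.im = 0

/-- The `a`-eigenvalues of `x`, with multiplicity: the negatives of the zeros of
`t ↦ P(t a + x)`. For hyperbolic `P` they are the real numbers `μ` in the factorization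
`P(t a + x) = P(a) ∏ (t + μ)`. -/
def hypEigenvalues {n : ℕ} (P : MvPolynomial (Fin n) ℝ) (a x : Fin n → ℝ) : Multiset ℝ :=
  (linePoly P a x).roots.map fun r => -r

/-- The (open) hyperbolicity cone, or Gårding cone, `Γ(P; a)`. -/
def hypCone {n : ℕ} (P : MvPolynomial (Fin n) ℝ) (a : Fin n → ℝ) : Set (Fin n → ℝ) :=
  {x | ∀ μ ∈ hypEigenvalues P a x, 0 < μ}

end

/-! The argument is majorization. If `x` is in the cone, then `P` is also hyperbolic with respect to
`x` and the old cone lies in the cone of `x` (`IsHyperbolicWrt.of_mem_hypCone`,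
`IsHyperbolicWrt.hypCone_subset`). For `y` in the cone, `P(sx + ty) = P(x) ∏ (s + tμ)` with all `μ >
0`, and AM-GM on each factor makes `P` log-concave, so its positive superlevel sets in the cone are
convex. By Birkhoff's theorem a doubly stochastic `M` averages permutations, so symmetry gives `P(x)
≤ P(Mx)` (`IsHyperbolicWrt.le_eval_mulVec`).

The diagonal of `UAUᵀ` is such an image of the eigenvalues, and `(tr A / n) 1` is one of that
diagonal. Both facts about the cone come from moving roots continuously along a connected family. -/

open Polynomial Filter Topology

/-! ### Roots in continuous families of complex polynomials. -/

section RootPersistence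

variable {S : Type*} [TopologicalSpace S] {f : S → ℂ[X]} {k : ℕ} {c : ℂ}

/-- Roots of a continuous family of complex polynomials of constant degree and constant leading
coefficient persist under small perturbations. -/
theorem eventually_exists_isRoot_mem (hc : c ≠ 0) (hdeg : ∀ s, (f s).natDegree ≤ k)
    (hlead : ∀ s, (f s).coeff k = c) (hcont : ∀ z, Continuous fun s => (f s).eval z)
    {s₀ : S} {z₀ : ℂ} (hz₀ : (f s₀).IsRoot z₀) {O : Set ℂ} (hO : O ∈ 𝓝 z₀) :
    ∀ᶠ s in 𝓝 s₀, ∃ z ∈ O, (f s).IsRoot z := by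
  obtain ⟨ε, hε, hball⟩ := Metric.mem_nhds_iff.1 hO
  have hlim : Tendsto (fun s => ‖(f s).eval z₀‖) (𝓝 s₀) (𝓝 0) := by
    have := ((hcont z₀).norm).tendsto s₀
    rwa [hz₀.eq_zero, norm_zero] at this
  have hpos : 0 < ‖c‖ * ε ^ k := by positivity
  filter_upwards [hlim.eventually_lt_const hpos] with s hs
  -- With no root in the ball, all `k` roots are at distance at least `ε` from `z₀`, which forces
  -- the value at `z₀` to be at least `‖c‖ ε ^ k` in norm.
  by_contra! hno
  have hnat : (f s).natDegree = k :=
    natDegree_eq_of_le_of_coeff_ne_zero (hdeg s) (by rw [hlead]; exact hc)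
  have hspl : (f s).Splits := IsAlgClosed.splits _
  have hcard : (f s).roots.card = k := by rw [← hspl.natDegree_eq_card_roots, hnat]
  have hprod : ε ^ k ≤ ((f s).roots.map fun r => ‖z₀ - r‖).prod := by
    rw [← hcard, ← Multiset.prod_replicate, ← Multiset.map_const']
    refine Multiset.prod_map_le_prod_map₀ _ _ (fun _ _ => hε.le) fun r hr => ?_
    by_contra! hlt
    exact hno r (hball (by rwa [Metric.mem_ball, dist_comm, dist_eq_norm])) (isRoot_of_mem_roots hr)
  have heval : ‖(f s).eval z₀‖ = ‖c‖ * ((f s).roots.map fun r => ‖z₀ - r‖).prod := by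
    rw [hspl.eval_eq_prod_roots, norm_mul, leadingCoeff, hnat, hlead,
      show ‖((f s).roots.map (z₀ - ·)).prod‖ = normHom ((f s).roots.map (z₀ - ·)).prod from rfl,
      map_multiset_prod, Multiset.map_map]
    rfl
  rw [heval] at hs
  exact absurd hs (not_lt.2 (mul_le_mul_of_nonneg_left hprod (norm_nonneg c)))

/-- The parameters whose polynomial has a root in a given closed set form a closed set. -/
theorem isClosed_setOf_exists_isRoot_mem [CompactSpace S] (hc : c ≠ 0)
    (hdeg : ∀ s, (f s).natDegree ≤ k) (hlead : ∀ s, (f s).coeff k = c)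
    (hcoeff : ∀ j, Continuous fun s => (f s).coeff j) {F : Set ℂ} (hF : IsClosed F) :
    IsClosed {s | ∃ z ∈ F, (f s).IsRoot z} := by
  have hnat : ∀ s, (f s).natDegree = k := fun s =>
    natDegree_eq_of_le_of_coeff_ne_zero (hdeg s) (by rw [hlead]; exact hc)
  have hM : ∀ j, ∃ M : NNReal, ∀ s, ‖(f s).coeff j‖₊ ≤ M := fun j => by
    obtain ⟨M, hM⟩ := (isCompact_range (hcoeff j).nnnorm).bddAbove
    exact ⟨M, fun s => hM ⟨s, rfl⟩⟩
  choose M hM using hM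
  -- Dominates the Cauchy root bound of every member of the family, so only the compact part of `F`
  -- within this radius matters.
  let R : NNReal := (Finset.range k).sup M / ‖c‖₊ + 1
  have hbound : ∀ s z, (f s).IsRoot z → z ∈ Metric.closedBall (0 : ℂ) R := by
    intro s z hz
    have hne : f s ≠ 0 := fun h => hc (by rw [← hlead s, h, coeff_zero])
    have h1 := (hz.norm_lt_cauchyBound hne).le
    have h2 : cauchyBound (f s) ≤ R := by
      rw [cauchyBound, leadingCoeff, hnat, hlead]
      change _ ≤ (Finset.range k).sup M / ‖c‖₊ + 1
      gcongr
      exact hM _ s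
    rw [mem_closedBall_zero_iff]
    exact h1.trans (by exact_mod_cast h2)
  have hev : Continuous fun p : S × ℂ => (f p.1).eval p.2 := by
    have : (fun p : S × ℂ => (f p.1).eval p.2)
        = fun p => ∑ j ∈ Finset.range (k + 1), (f p.1).coeff j * p.2 ^ j := by
      funext p
      rw [eval_eq_sum_range, hnat]
    rw [this]
    exact continuous_finsetSum _ fun j _ =>
      ((hcoeff j).comp continuous_fst).mul (continuous_snd.pow j)
  have hset : {s | ∃ z ∈ F, (f s).IsRoot z}ᶜ =
      {s | ∀ z ∈ F ∩ Metric.closedBall (0 : ℂ) R, (f s).eval z ≠ 0} := by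
    ext s
    simp only [Set.mem_compl_iff, Set.mem_ofPred_eq, not_exists, not_and]
    exact ⟨fun h z hz h0 => h z hz.1 h0, fun h z hz h0 => h z ⟨hz, hbound s z h0⟩ h0⟩
  rw [← isOpen_compl_iff, hset, isOpen_iff_mem_nhds]
  intro s hs
  exact ((isCompact_closedBall (0 : ℂ)
    (R : ℝ)).inter_left hF).eventually_forall_of_forall_eventually
    fun z hz => (hev.continuousAt (x := (s, z))).eventually_ne (hs z hz)

/-- Along a connected compact family, roots cannot enter a closed set if every root in the closed
set lies in an open subset of it. -/
theorem forall_isRoot_notMem_of_preconnected [CompactSpace S] [PreconnectedSpace S] (hc : c ≠ 0)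
    (hdeg : ∀ s, (f s).natDegree ≤ k) (hlead : ∀ s, (f s).coeff k = c)
    (hcoeff : ∀ j, Continuous fun s => (f s).coeff j)
    (heval : ∀ z, Continuous fun s => (f s).eval z) {O F : Set ℂ} (hO : IsOpen O)
    (hF : IsClosed F) (hOF : O ⊆ F) (hroots : ∀ s z, (f s).IsRoot z → z ∈ F → z ∈ O)
    {s₀ : S} (h₀ : ∀ z, (f s₀).IsRoot z → z ∉ F) (s : S) (z : ℂ) (hz : (f s).IsRoot z) :
    z ∉ F := by
  have hclopen : IsClopen {s | ∃ z ∈ F, (f s).IsRoot z} := by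
    refine ⟨isClosed_setOf_exists_isRoot_mem hc hdeg hlead hcoeff hF, ?_⟩
    rw [isOpen_iff_mem_nhds]
    rintro s ⟨z, hzF, hz⟩
    filter_upwards [eventually_exists_isRoot_mem hc hdeg hlead heval hz
      (hO.mem_nhds (hroots s z hz hzF))] with s' ⟨z', hz', hr⟩
    exact ⟨z', hOF hz', hr⟩
  rcases isClopen_iff.1 hclopen with h | h
  · intro hzF
    exact Set.eq_empty_iff_forall_notMem.1 h s ⟨z, hzF, hz⟩
  · obtain ⟨z, hzF, hz⟩ := Set.eq_univ_iff_forall.1 h s₀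
    exact absurd hzF (h₀ z hz)

end RootPersistence

/-! ### Restriction of a polynomial to lines. -/

section RestrictLine

variable {σ R B : Type*} [CommSemiring R] [CommSemiring B] [Algebra R B]

/-- The univariate polynomial `t ↦ P (t x + w)` with coefficients in an algebra. -/
noncomputable def restrictLine (P : MvPolynomial σ R) (x w : σ → B) : B[X] :=
  MvPolynomial.aeval (fun i => C (x i) * X + C (w i)) P

theorem eval_restrictLine (P : MvPolynomial σ R) (x w : σ → B) (t : B) :
    (restrictLine P x w).eval t = MvPolynomial.aeval (t • x + w) P := by
  change ((aeval t).restrictScalars R) _ = _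
  rw [restrictLine, MvPolynomial.comp_aeval_apply]
  congr 2
  funext i
  change (C (x i) * X + C (w i)).eval t = t * x i + w i
  rw [eval_add, eval_mul, eval_C, eval_X, eval_C, mul_comm]

theorem natDegree_restrictLine_le_and_coeff {P : MvPolynomial σ R} {k : ℕ}
    (hP : P.IsHomogeneous k) (x w : σ → B) :
    (restrictLine P x w).natDegree ≤ k ∧
      (restrictLine P x w).coeff k = MvPolynomial.aeval x P := by
  have hlin : ∀ i, (C (x i) * X + C (w i)).natDegree ≤ 1 := fun i => natDegree_linear_le
  have hmon : ∀ (d : σ →₀ ℕ) (s : Finset σ),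
      (∏ i ∈ s, (C (x i) * X + C (w i)) ^ d i).natDegree ≤ ∑ i ∈ s, d i ∧
      (∏ i ∈ s, (C (x i) * X + C (w i)) ^ d i).coeff (∑ i ∈ s, d i) = ∏ i ∈ s, x i ^ d i := by
    classical
    intro d s
    induction s using Finset.induction_on with
    | empty => simp
    | insert i s hi ih =>
      have hpow : ((C (x i) * X + C (w i)) ^ d i).natDegree ≤ d i := by
        simpa using natDegree_pow_le_of_le (d i) (hlin i)
      rw [Finset.prod_insert hi, Finset.sum_insert hi, Finset.prod_insert hi]
      refine ⟨natDegree_mul_le_of_le hpow ih.1, ?_⟩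
      rw [coeff_mul_add_eq_of_natDegree_le hpow ih.1, ih.2]
      congr 1
      have := coeff_pow_of_natDegree_le (m := d i) (hlin i)
      simpa using this
  have hterm : ∀ d ∈ P.support, ∑ i ∈ d.support, d i = k := fun d hd => by
    have := hP (MvPolynomial.mem_support_iff.1 hd)
    rwa [Pi.one_def, ← Finsupp.degree_eq_weight_one] at this
  rw [restrictLine, MvPolynomial.aeval_def, MvPolynomial.eval₂_eq, MvPolynomial.aeval_def,
    MvPolynomial.eval₂_eq]
  constructor
  · refine natDegree_sum_le_of_forall_le _ _ fun d hd => ?_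
    rw [IsScalarTower.algebraMap_apply R B B[X], ← C_eq_algebraMap]
    exact (natDegree_C_mul_le _ _).trans ((hmon d d.support).1.trans (hterm d hd).le)
  · rw [finsetSum_coeff]
    refine Finset.sum_congr rfl fun d hd => ?_
    rw [IsScalarTower.algebraMap_apply R B B[X], ← C_eq_algebraMap, coeff_C_mul]
    rw [← (hmon d d.support).2, hterm d hd]

theorem aeval_smul_of_isHomogeneous {P : MvPolynomial σ R} {k : ℕ}
    (hP : P.IsHomogeneous k) (r : B) (x : σ → B) :
    MvPolynomial.aeval (r • x) P = r ^ k * MvPolynomial.aeval x P := by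
  rw [MvPolynomial.aeval_def, MvPolynomial.eval₂_eq, MvPolynomial.aeval_def,
    MvPolynomial.eval₂_eq, Finset.mul_sum]
  refine Finset.sum_congr rfl fun d hd => ?_
  have hk : ∑ i ∈ d.support, d i = k := by
    have := hP (MvPolynomial.mem_support_iff.1 hd)
    rwa [Pi.one_def, ← Finsupp.degree_eq_weight_one] at this
  simp only [Pi.smul_apply, smul_eq_mul, mul_pow, Finset.prod_mul_distrib,
    Finset.prod_pow_eq_pow_sum, hk]
  ring

/-- Treating the base point as an indeterminate exhibits each coefficient in `t` as a fixed
polynomial evaluated at `w`; continuity in `w` follows. -/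
theorem restrictLine_eq_map (P : MvPolynomial σ R) (x w : σ → B) :
    restrictLine P x w =
      (restrictLine P (fun i => MvPolynomial.C (x i)) MvPolynomial.X :
        (MvPolynomial σ B)[X]).map (MvPolynomial.eval w) := by
  rw [restrictLine, restrictLine, MvPolynomial.aeval_def, MvPolynomial.aeval_def,
    ← coe_mapRingHom, MvPolynomial.hom_eval₂]
  congr 1
  · ext r
    simp [IsScalarTower.algebraMap_apply R B B[X],
      IsScalarTower.algebraMap_apply R (MvPolynomial σ B) (MvPolynomial σ B)[X],
      IsScalarTower.algebraMap_apply R B (MvPolynomial σ B), MvPolynomial.algebraMap_eq]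
  · funext i
    simp

theorem continuous_coeff_restrictLine [TopologicalSpace B] [IsTopologicalSemiring B]
    (P : MvPolynomial σ R) (x : σ → B) (j : ℕ) :
    Continuous fun w => (restrictLine P x w).coeff j := by
  simp_rw [restrictLine_eq_map P x, coeff_map]
  exact MvPolynomial.continuous_eval _

theorem continuous_eval_restrictLine [TopologicalSpace B] [IsTopologicalSemiring B]
    (P : MvPolynomial σ R) (x : σ → B) (t : B) :
    Continuous fun w => (restrictLine P x w).eval t := by
  have h : (fun w => (restrictLine P x w).eval t) =
      fun w => MvPolynomial.eval (t • x + w) (MvPolynomial.map (algebraMap R B) P) := by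
    funext w
    rw [eval_restrictLine, MvPolynomial.aeval_def, MvPolynomial.eval₂_eq_eval_map]
  rw [h]
  exact (MvPolynomial.continuous_eval _).comp (continuous_const.add continuous_id)

end RestrictLine

/-! ### Gårding's theory of hyperbolic polynomials. -/

section Hyperbolic

variable {n k : ℕ} {P : MvPolynomial (Fin n) ℝ} {a x y : Fin n → ℝ}

theorem aeval_ofReal_comp (P : MvPolynomial (Fin n) ℝ) (x : Fin n → ℝ) :
    MvPolynomial.aeval (fun i => (x i : ℂ)) P = ((MvPolynomial.eval x P : ℝ) : ℂ) := by
  have h := MvPolynomial.comp_aeval_apply (f := x) (Algebra.ofId ℝ ℂ) P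
  rw [← MvPolynomial.coe_aeval_eq_eval]
  exact h.symm

theorem aeval_linePoly (P : MvPolynomial (Fin n) ℝ) (x w : Fin n → ℝ) (z : ℂ) :
    aeval z (linePoly P x w) = MvPolynomial.aeval (fun i => z * x i + w i) P := by
  change (aeval z) (MvPolynomial.aeval _ P) = _
  rw [MvPolynomial.comp_aeval_apply]
  congr 2
  funext i
  rw [map_add, map_mul, aeval_C, aeval_X, aeval_C, mul_comm]
  rfl

theorem eval_linePoly (P : MvPolynomial (Fin n) ℝ) (x w : Fin n → ℝ) (t : ℝ) :
    (linePoly P x w).eval t = MvPolynomial.eval (t • x + w) P :=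
  eval_restrictLine P x w t

theorem eval_smul_of_isHomogeneous (hP : P.IsHomogeneous k) (r : ℝ) (x : Fin n → ℝ) :
    MvPolynomial.eval (r • x) P = r ^ k * MvPolynomial.eval x P :=
  aeval_smul_of_isHomogeneous hP r x

theorem natDegree_linePoly (hP : P.IsHomogeneous k) (hx : MvPolynomial.eval x P ≠ 0)
    (w : Fin n → ℝ) : (linePoly P x w).natDegree = k := by
  obtain ⟨h1, h2⟩ := natDegree_restrictLine_le_and_coeff hP x w
  refine natDegree_eq_of_le_of_coeff_ne_zero h1 ?_
  change (restrictLine P x w).coeff k ≠ 0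
  rw [h2]
  exact hx

theorem leadingCoeff_linePoly (hP : P.IsHomogeneous k) (hx : MvPolynomial.eval x P ≠ 0)
    (w : Fin n → ℝ) : (linePoly P x w).leadingCoeff = MvPolynomial.eval x P := by
  rw [leadingCoeff, natDegree_linePoly hP hx]
  exact (natDegree_restrictLine_le_and_coeff hP x w).2

theorem linePoly_ne_zero (hP : P.IsHomogeneous k) (hx : MvPolynomial.eval x P ≠ 0)
    (w : Fin n → ℝ) : linePoly P x w ≠ 0 := by
  rw [← leadingCoeff_ne_zero, leadingCoeff_linePoly hP hx]
  exact hx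

theorem IsHyperbolicWrt.linePoly_splits (h : IsHyperbolicWrt k P a) (x : Fin n → ℝ) :
    (linePoly P a x).Splits := by
  refine Splits.of_splits_map (algebraMap ℝ ℂ) (IsAlgClosed.splits _) fun z hz => ?_
  rw [mem_roots_map (linePoly_ne_zero h.isHomogeneous h.eval_pos.ne' x)] at hz
  exact ⟨z.re, Complex.ext rfl (h.zeros_real x z hz).symm⟩

/-- Trades eigenvalue multisets for non-vanishing on a ray, the form in which root-motion arguments
apply. -/
theorem IsHyperbolicWrt.mem_hypCone_iff (h : IsHyperbolicWrt k P a) :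
    x ∈ hypCone P a ↔ ∀ r : ℝ, 0 ≤ r → MvPolynomial.eval (r • a + x) P ≠ 0 := by
  simp only [hypCone, hypEigenvalues, Multiset.mem_map, Set.mem_ofPred_eq, forall_exists_index,
    and_imp, forall_apply_eq_imp_iff₂,
    mem_roots (linePoly_ne_zero h.isHomogeneous h.eval_pos.ne' x),
    IsRoot.def, eval_linePoly, Left.neg_pos_iff]
  exact ⟨fun H r hr h0 => not_lt.2 hr (H r h0), fun H r h0 => not_le.1 fun hr => H r hr h0⟩

/-- The factorization of `t ↦ P (t a + x)` into linear factors, made homogeneous. -/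
theorem IsHyperbolicWrt.eval_smul_add_smul (h : IsHyperbolicWrt k P a) (s t : ℝ)
    (x : Fin n → ℝ) :
    MvPolynomial.eval (s • a + t • x) P =
      MvPolynomial.eval a P * ((hypEigenvalues P a x).map fun μ => s + t * μ).prod := by
  have hcard : (hypEigenvalues P a x).card = k := by
    rw [hypEigenvalues, Multiset.card_map, ← (h.linePoly_splits x).natDegree_eq_card_roots,
      natDegree_linePoly h.isHomogeneous h.eval_pos.ne']
  have hone : ∀ u : ℝ, MvPolynomial.eval (u • a + x) P =
      MvPolynomial.eval a P * ((hypEigenvalues P a x).map fun μ => u + μ).prod := fun u => by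
    rw [← eval_linePoly, (h.linePoly_splits x).eval_eq_prod_roots,
      leadingCoeff_linePoly h.isHomogeneous h.eval_pos.ne', hypEigenvalues, Multiset.map_map]
    rfl
  rcases eq_or_ne t 0 with rfl | ht
  · simp [eval_smul_of_isHomogeneous h.isHomogeneous, hcard, mul_comm]
  · have : s • a + t • x = t • ((s / t) • a + x) := by
      rw [smul_add, smul_smul, mul_div_cancel₀ _ ht]
    rw [this, eval_smul_of_isHomogeneous h.isHomogeneous, hone, ← hcard, mul_left_comm,
      ← Multiset.prod_replicate, ← Multiset.map_const', ← Multiset.prod_map_mul]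
    congr 3
    funext μ
    field_simp

theorem IsHyperbolicWrt.eval_eq_mul_prod (h : IsHyperbolicWrt k P a) (x : Fin n → ℝ) :
    MvPolynomial.eval x P = MvPolynomial.eval a P * (hypEigenvalues P a x).prod := by
  simpa using h.eval_smul_add_smul 0 1 x

theorem IsHyperbolicWrt.eval_pos_of_mem_hypCone (h : IsHyperbolicWrt k P a)
    (hx : x ∈ hypCone P a) : 0 < MvPolynomial.eval x P := by
  rw [h.eval_eq_mul_prod x]
  exact mul_pos h.eval_pos (Multiset.prod_pos hx)

theorem IsHyperbolicWrt.im_eq_zero (h : IsHyperbolicWrt k P a) {z : ℂ} {w : Fin n → ℝ}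
    (hz : MvPolynomial.aeval (fun i => z * a i + w i) P = 0) : z.im = 0 :=
  h.zeros_real w z (by rwa [aeval_linePoly])

/-- If `x` lies in the hyperbolicity cone, then the roots of `t ↦ P (i α a + t x + y)` lie in the
open lower half-plane for `α > 0`. -/
theorem IsHyperbolicWrt.im_neg_of_aeval_eq_zero (h : IsHyperbolicWrt k P a)
    (hx : x ∈ hypCone P a) {α : ℝ} (hα : 0 < α) (y : Fin n → ℝ) {z : ℂ}
    (hz : MvPolynomial.aeval (fun i => z * x i + (α * Complex.I * a i + y i)) P = 0) :
    z.im < 0 := by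
  have hP := h.isHomogeneous
  -- The homotopy scales `y` from `0` to `1`; roots in `t` never cross the real axis, so it suffices
  -- to locate them at `s = 0`.
  let w : unitInterval → Fin n → ℂ := fun s i => α * Complex.I * a i + (s : ℝ) * y i
  have hw : Continuous w := by fun_prop
  let xc : Fin n → ℂ := fun i => x i
  have hroot : ∀ s t, (restrictLine P xc (w s)).IsRoot t ↔
      MvPolynomial.aeval (fun i => t * x i + (α * Complex.I * a i + (s : ℝ) * y i)) P = 0 :=
    fun s t => by rw [IsRoot.def, eval_restrictLine]; rfl
  have hc : MvPolynomial.aeval xc P ≠ 0 := by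
    rw [aeval_ofReal_comp]
    exact_mod_cast (h.eval_pos_of_mem_hypCone hx).ne'
  have hαI : (α * Complex.I : ℂ).im ≠ 0 := by simpa using hα.ne'
  have key := forall_isRoot_notMem_of_preconnected (f := fun s => restrictLine P xc (w s)) hc
    (fun s => (natDegree_restrictLine_le_and_coeff hP xc (w s)).1)
    (fun s => (natDegree_restrictLine_le_and_coeff hP xc (w s)).2)
    (fun j => (continuous_coeff_restrictLine P xc j).comp hw)
    (fun t => (continuous_eval_restrictLine P xc t).comp hw)
    (O := {z | 0 < z.im}) (F := {z | 0 ≤ z.im})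
    (isOpen_lt continuous_const Complex.continuous_im)
    (isClosed_le continuous_const Complex.continuous_im) (fun z (hz : 0 < z.im) => hz.le)
    -- A real root `t` would make the non-real number `iα` a zero of `ζ ↦ P(ζ a + w)` with `w` real.
    (fun s t ht (him : 0 ≤ t.im) => by
      refine lt_of_le_of_ne him fun h0 => hαI (h.im_eq_zero (w := t.re • x + (s : ℝ) • y) ?_)
      rw [← (hroot s t).1 ht]
      congr 2
      funext i
      have : t = t.re := Complex.ext rfl h0.symm
      rw [this]
      simp only [Pi.add_apply, Pi.smul_apply, smul_eq_mul, Complex.ofReal_add, Complex.ofReal_mul,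
        Complex.ofReal_re]
      ring)
    (s₀ := 0)
    -- At `s = 0`, homogeneity makes `iα / t` a zero of `ζ ↦ P(ζ a + x)`, hence a real `r`. Since `α
    -- = r * t.im` with `α > 0`, `0 ≤ t.im` gives `0 ≤ r`, impossible for `x` in the cone.
    (fun t ht (him : 0 ≤ t.im) => by
      have h0 := (hroot 0 t).1 ht
      have ht0 : t ≠ 0 := by
        rintro rfl
        refine hαI (h.im_eq_zero (w := 0) ?_)
        rw [← h0]
        congr 2
        funext i
        simp
      have h1 : MvPolynomial.aeval (fun i => (α * Complex.I / t) * a i + x i) P = 0 := by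
        have : (fun i => t * x i + (α * Complex.I * a i + ((0 : unitInterval) : ℝ) * y i)) =
            t • fun i => (α * Complex.I / t) * a i + x i := by
          funext i
          simp only [Pi.smul_apply, smul_eq_mul, Set.Icc.coe_zero, Complex.ofReal_zero]
          field_simp
          ring
        rw [this, aeval_smul_of_isHomogeneous hP] at h0
        exact (mul_eq_zero.1 h0).resolve_left (pow_ne_zero _ ht0)
      have h2 := h.im_eq_zero h1
      obtain ⟨r, hr⟩ : ∃ r : ℝ, (α * Complex.I / t : ℂ) = r := ⟨_, Complex.ext rfl h2⟩
      have hr' : (α * Complex.I : ℂ) = r * t := by rw [← hr, div_mul_cancel₀ _ ht0]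
      have him' : α = r * t.im := by simpa using congrArg Complex.im hr'
      have hr0 : 0 ≤ r := by
        by_contra! hneg
        nlinarith
      rw [hr] at h1
      refine h.mem_hypCone_iff.1 hx r hr0 ?_
      rw [← Complex.ofReal_eq_zero, ← aeval_ofReal_comp, ← h1]
      congr 2
      funext i
      simp)
    1 z ((hroot 1 z).2 (by simpa using hz))
  exact not_le.1 key

theorem aeval_conj (P : MvPolynomial (Fin n) ℝ) (v : Fin n → ℂ) :
    MvPolynomial.aeval (fun i => starRingEnd ℂ (v i)) P =
      starRingEnd ℂ (MvPolynomial.aeval v P) :=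
  (MvPolynomial.comp_aeval_apply (f := v) Complex.conjAe.toAlgHom P).symm

/-- A hyperbolic polynomial is hyperbolic with respect to every vector of its cone. -/
theorem IsHyperbolicWrt.of_mem_hypCone (h : IsHyperbolicWrt k P a) (hx : x ∈ hypCone P a) :
    IsHyperbolicWrt k P x := by
  have hP := h.isHomogeneous
  have hc : MvPolynomial.aeval (fun i => (x i : ℂ)) P ≠ 0 := by
    rw [aeval_ofReal_comp]
    exact_mod_cast (h.eval_pos_of_mem_hypCone hx).ne'
  have hle : ∀ (y : Fin n → ℝ) (z : ℂ),
      MvPolynomial.aeval (fun i => z * x i + y i) P = 0 → z.im ≤ 0 := by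
    intro y z hz
    by_contra! him
    -- A root in the open upper half-plane would persist after adding `iα a` for small `α > 0`,
    -- where all roots have negative imaginary part.
    let w : ℝ → Fin n → ℂ := fun α i => α * Complex.I * a i + y i
    have hw : Continuous w := by fun_prop
    have hev := eventually_exists_isRoot_mem
      (f := fun α => restrictLine P (fun i => (x i : ℂ)) (w α)) hc
      (fun α => (natDegree_restrictLine_le_and_coeff hP _ _).1)
      (fun α => (natDegree_restrictLine_le_and_coeff hP _ _).2)
      (fun t => (continuous_eval_restrictLine P _ t).comp hw) (s₀ := 0) (z₀ := z)
      (by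
        rw [IsRoot.def, eval_restrictLine, ← hz]
        congr 2
        funext i
        simp [w])
      ((isOpen_lt continuous_const Complex.continuous_im).mem_nhds him)
    obtain ⟨α, ⟨z', hz', hroot⟩, hα⟩ :=
      ((hev.filter_mono nhdsWithin_le_nhds).and (self_mem_nhdsWithin (s := Set.Ioi (0 : ℝ)))).exists
    rw [IsRoot.def, eval_restrictLine] at hroot
    exact lt_asymm hz' (h.im_neg_of_aeval_eq_zero hx hα y hroot)
  refine ⟨hP, h.eval_pos_of_mem_hypCone hx, fun y z hz => ?_⟩
  rw [aeval_linePoly] at hz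
  refine le_antisymm (hle y z hz) ?_
  -- `P` is real, so roots come in conjugate pairs and the upper bound on imaginary parts is also a
  -- lower bound.
  have := hle y (starRingEnd ℂ z) (by
    have hconj := aeval_conj P fun i => z * x i + y i
    rw [hz, map_zero] at hconj
    simpa using hconj)
  simpa using this

/-- Move `y` to `a` along a segment. The roots in `t` stay real, by hyperbolicity along `x`, and
never vanish, as `P` is nonzero on the segment. At `a` they are all negative, hence also at `y`. -/
theorem IsHyperbolicWrt.eval_smul_add_ne_zero (h : IsHyperbolicWrt k P a)
    (hx : x ∈ hypCone P a) (hy : y ∈ hypCone P a) {r : ℝ} (hr : 0 ≤ r) :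
    MvPolynomial.eval (r • x + y) P ≠ 0 := by
  have hP := h.isHomogeneous
  let w : unitInterval → Fin n → ℂ := fun s i => (s : ℝ) * a i + (1 - (s : ℝ)) * y i
  have hw : Continuous w := by fun_prop
  let xc : Fin n → ℂ := fun i => x i
  have hroot : ∀ s t, (restrictLine P xc (w s)).IsRoot t ↔
      MvPolynomial.aeval (fun i => t * x i + ((s : ℝ) • a + (1 - (s : ℝ)) • y) i) P = 0 :=
    fun s t => by
      rw [IsRoot.def, eval_restrictLine]
      congr! 3
      funext i
      simp [w, xc]
  have hreal : ∀ s t, (restrictLine P xc (w s)).IsRoot t →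
      t.im = 0 ∧ MvPolynomial.eval (t.re • x + ((s : ℝ) • a + (1 - (s : ℝ)) • y)) P = 0 := by
    intro s t ht
    have h0 := (hroot s t).1 ht
    have him := (h.of_mem_hypCone hx).im_eq_zero h0
    refine ⟨him, ?_⟩
    rw [← Complex.ofReal_eq_zero, ← aeval_ofReal_comp, ← h0]
    congr 2
    funext i
    have : t = t.re := Complex.ext rfl him
    nth_rw 2 [this]
    simp
  have hc : MvPolynomial.aeval xc P ≠ 0 := by
    rw [aeval_ofReal_comp]
    exact_mod_cast (h.eval_pos_of_mem_hypCone hx).ne'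
  have hseg : ∀ s : unitInterval, MvPolynomial.eval ((s : ℝ) • a + (1 - (s : ℝ)) • y) P ≠ 0 := by
    intro s
    rw [h.eval_smul_add_smul]
    refine mul_ne_zero h.eval_pos.ne' (Multiset.prod_pos fun v hv => ?_).ne'
    obtain ⟨μ, hμ, rfl⟩ := Multiset.mem_map.1 hv
    have := hy μ hμ
    have h0 := s.2.1
    rcases h0.eq_or_lt with h0 | h0
    · rw [← h0]; linarith
    · exact add_pos_of_pos_of_nonneg h0 (mul_nonneg (sub_nonneg.2 s.2.2) this.le)
  have key := forall_isRoot_notMem_of_preconnected (f := fun s => restrictLine P xc (w s)) hc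
    (fun s => (natDegree_restrictLine_le_and_coeff hP xc (w s)).1)
    (fun s => (natDegree_restrictLine_le_and_coeff hP xc (w s)).2)
    (fun j => (continuous_coeff_restrictLine P xc j).comp hw)
    (fun t => (continuous_eval_restrictLine P xc t).comp hw)
    (O := {z | 0 < z.re}) (F := {z | 0 ≤ z.re})
    (isOpen_lt continuous_const Complex.continuous_re)
    (isClosed_le continuous_const Complex.continuous_re) (fun z (hz : 0 < z.re) => hz.le)
    (fun s t ht (hre : 0 ≤ t.re) => by
      refine lt_of_le_of_ne hre fun h0 => hseg s ?_
      simpa [← h0] using (hreal s t ht).2)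
    (s₀ := 1)
    (fun t ht (hre : 0 ≤ t.re) => by
      have h1 := (hreal 1 t ht).2
      rw [show t.re • x + (((1 : unitInterval) : ℝ) • a + (1 - ((1 : unitInterval) : ℝ)) • y) =
        (1 : ℝ) • a + t.re • x by simp [add_comm], h.eval_smul_add_smul] at h1
      refine mul_ne_zero h.eval_pos.ne' (Multiset.prod_pos fun v hv => ?_).ne' h1
      obtain ⟨μ, hμ, rfl⟩ := Multiset.mem_map.1 hv
      have := hx μ hμ
      positivity)
    0 r
  intro h0
  refine key ((hroot 0 r).2 ?_) (by simpa using hr)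
  rw [← Complex.ofReal_eq_zero, ← aeval_ofReal_comp] at h0
  rw [← h0]
  congr 2
  funext i
  simp

theorem IsHyperbolicWrt.hypCone_subset (h : IsHyperbolicWrt k P a) (hx : x ∈ hypCone P a) :
    hypCone P a ⊆ hypCone P x := fun _ hy =>
  (h.of_mem_hypCone hx).mem_hypCone_iff.2 fun _ hr => h.eval_smul_add_ne_zero hx hy hr

theorem IsHyperbolicWrt.smul_add_smul_mem_hypCone (h : IsHyperbolicWrt k P a)
    (hx : x ∈ hypCone P a) (hy : y ∈ hypCone P a) {s t : ℝ} (hs : 0 < s) (ht : 0 < t) :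
    s • x + t • y ∈ hypCone P a := by
  refine h.mem_hypCone_iff.2 fun r hr => ?_
  have hy' : (r / t) • a + y ∈ hypCone P a := by
    refine h.mem_hypCone_iff.2 fun u hu => ?_
    rw [← add_assoc, ← add_smul]
    exact h.mem_hypCone_iff.1 hy _ (by positivity)
  have hsum : r • a + (s • x + t • y) = t • ((s / t) • x + ((r / t) • a + y)) := by
    simp only [smul_add, smul_smul, mul_div_cancel₀ _ ht.ne']
    abel
  rw [hsum, eval_smul_of_isHomogeneous h.isHomogeneous]
  exact mul_ne_zero (by positivity) (h.eval_smul_add_ne_zero hx hy' (by positivity))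

/-- Weighted AM-GM for `1` and `μ` gives `μ ^ t ≤ s + t * μ` factor by factor. -/
theorem Multiset.prod_rpow_le_prod_add_mul {m : Multiset ℝ} (hm : ∀ μ ∈ m, 0 < μ) {s t : ℝ}
    (hs : 0 ≤ s) (ht : 0 ≤ t) (hst : s + t = 1) :
    m.prod ^ t ≤ (m.map fun μ => s + t * μ).prod := by
  induction m using Multiset.induction_on with
  | empty => simp
  | cons μ m ih =>
    have hμ := hm μ (Multiset.mem_cons_self μ m)
    have hm' : ∀ ν ∈ m, 0 < ν := fun ν hν => hm ν (Multiset.mem_cons_of_mem hν)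
    have hpos := Multiset.prod_pos hm'
    rw [Multiset.prod_cons, Multiset.map_cons, Multiset.prod_cons, Real.mul_rpow hμ.le hpos.le]
    have hamgm := Real.geom_mean_le_arith_mean2_weighted hs ht zero_le_one hμ.le hst
    rw [Real.one_rpow, one_mul, mul_one] at hamgm
    exact mul_le_mul hamgm (ih hm') (by positivity) (by positivity)

/-- A hyperbolic polynomial is logarithmically concave on its cone. -/
theorem IsHyperbolicWrt.rpow_mul_rpow_le_eval (h : IsHyperbolicWrt k P a)
    (hx : x ∈ hypCone P a) (hy : y ∈ hypCone P a) {s t : ℝ} (hs : 0 ≤ s) (ht : 0 ≤ t)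
    (hst : s + t = 1) :
    MvPolynomial.eval x P ^ s * MvPolynomial.eval y P ^ t ≤
      MvPolynomial.eval (s • x + t • y) P := by
  have hpx := h.eval_pos_of_mem_hypCone hx
  have hx' := h.of_mem_hypCone hx
  have hyx : ∀ μ ∈ hypEigenvalues P x y, 0 < μ := h.hypCone_subset hx hy
  rw [hx'.eval_smul_add_smul, hx'.eval_eq_mul_prod y,
    Real.mul_rpow hpx.le (Multiset.prod_pos hyx).le, ← mul_assoc, ← Real.rpow_add hpx, hst,
    Real.rpow_one]
  exact mul_le_mul_of_nonneg_left (Multiset.prod_rpow_le_prod_add_mul hyx hs ht hst) hpx.le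

theorem IsHyperbolicWrt.convex_superlevel (h : IsHyperbolicWrt k P a) {c : ℝ} (hc : 0 < c) :
    Convex ℝ {x | x ∈ hypCone P a ∧ c ≤ MvPolynomial.eval x P} := by
  rw [convex_iff_forall_pos]
  rintro x ⟨hx, hcx⟩ y ⟨hy, hcy⟩ s t hs ht hst
  refine ⟨h.smul_add_smul_mem_hypCone hx hy hs ht,
    le_trans ?_ (h.rpow_mul_rpow_le_eval hx hy hs.le ht.le hst)⟩
  calc c = c ^ s * c ^ t := by rw [← Real.rpow_add hc, hst, Real.rpow_one]
    _ ≤ _ := mul_le_mul (Real.rpow_le_rpow hc.le hcx hs.le) (Real.rpow_le_rpow hc.le hcy ht.le)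
        (by positivity) (Real.rpow_nonneg (hc.le.trans hcx) s)

end Hyperbolic

/-! ### Schur-concavity. -/

section Symmetric

variable {n k : ℕ} {P : MvPolynomial (Fin n) ℝ}

theorem MvPolynomial.IsSymmetric.eval_comp_perm (hP : P.IsSymmetric) (σ : Equiv.Perm (Fin n))
    (x : Fin n → ℝ) : MvPolynomial.eval (x ∘ σ) P = MvPolynomial.eval x P := by
  conv_rhs => rw [← hP σ, MvPolynomial.eval_rename]

/-- A symmetric hyperbolic polynomial is Schur-concave on its cone. -/
theorem IsHyperbolicWrt.le_eval_mulVec (h : IsHyperbolicWrt k P 1) (hP : P.IsSymmetric)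
    {x : Fin n → ℝ} (hx : x ∈ hypCone P 1) {M : Matrix (Fin n) (Fin n) ℝ}
    (hM : M ∈ doublyStochastic ℝ (Fin n)) :
    M *ᵥ x ∈ hypCone P 1 ∧ MvPolynomial.eval x P ≤ MvPolynomial.eval (M *ᵥ x) P := by
  have hconv := h.convex_superlevel (h.eval_pos_of_mem_hypCone hx)
  obtain ⟨w, hw, hw1, rfl⟩ := exists_eq_sum_perm_of_mem_doublyStochastic hM
  rw [Matrix.sum_mulVec]
  simp_rw [Matrix.smul_mulVec]
  refine hconv.sum_mem (fun σ _ => hw σ) hw1 fun σ _ => ?_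
  have hperm : σ.permMatrix ℝ *ᵥ x = x ∘ σ := Matrix.permMatrix_mulVec σ
  rw [hperm]
  refine ⟨h.mem_hypCone_iff.2 fun r hr => ?_, (hP.eval_comp_perm σ x).ge⟩
  have : r • (1 : Fin n → ℝ) + x ∘ σ = (r • (1 : Fin n → ℝ) + x) ∘ σ := rfl
  rw [this, hP.eval_comp_perm]
  exact h.mem_hypCone_iff.1 hx r hr

end Symmetric

/-! ### Orthogonal matrices and doubly stochastic matrices. -/

section Orthogonal

variable {m : Type*} [Fintype m] [DecidableEq m]

/-- The matrix of squared entries of an orthogonal matrix is doubly stochastic. -/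
theorem Matrix.hadamard_self_mem_doublyStochastic {W : Matrix m m ℝ}
    (hW : W ∈ Matrix.orthogonalGroup m ℝ) : W ⊙ W ∈ doublyStochastic ℝ m := by
  rw [mem_doublyStochastic_iff_sum]
  refine ⟨fun i j => mul_self_nonneg _, fun i => ?_, fun j => ?_⟩
  · have := congrFun (congrFun (Matrix.mem_orthogonalGroup_iff m ℝ |>.1 hW) i) i
    simpa [Matrix.mul_apply] using this
  · have := congrFun (congrFun (Matrix.mem_orthogonalGroup_iff' m ℝ |>.1 hW) j) j
    simpa [Matrix.mul_apply] using this

theorem Matrix.diag_mul_diagonal_mul_transpose (W : Matrix m m ℝ) (d : m → ℝ) :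
    (W * diagonal d * Wᵀ).diag = (W ⊙ W) *ᵥ d := by
  funext i
  rw [diag_apply, mul_apply]
  simp only [mul_diagonal, transpose_apply, mulVec, dotProduct,
    hadamard_apply]
  exact Finset.sum_congr rfl fun j _ => by ring

end Orthogonal

/-! ### The inequalities for diagonals of orthogonal conjugates. -/

theorem corollary2p8 (n k : ℕ) (P : MvPolynomial (Fin n) ℝ)
    (hsymm : P.IsSymmetric) (hhyp : IsHyperbolicWrt k P (1 : Fin n → ℝ))
    (A : Matrix (Fin n) (Fin n) ℝ) (hA : A.IsHermitian)
    (hmem : hA.eigenvalues ∈ hypCone P (1 : Fin n → ℝ)) :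
    (∀ U ∈ Matrix.orthogonalGroup (Fin n) ℝ,
      MvPolynomial.eval hA.eigenvalues P ≤ MvPolynomial.eval (U * A * Uᵀ).diag P ∧
      MvPolynomial.eval (U * A * Uᵀ).diag P ≤
        MvPolynomial.eval ((A.trace / (n : ℝ)) • (1 : Fin n → ℝ)) P) ∧
    (∀ U ∈ Matrix.orthogonalGroup (Fin n) ℝ, (U * A * Uᵀ).IsDiag →
      MvPolynomial.eval (U * A * Uᵀ).diag P = MvPolynomial.eval hA.eigenvalues P) ∧
    (∃ U ∈ Matrix.orthogonalGroup (Fin n) ℝ, (U * A * Uᵀ).IsDiag) := by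
  let V : Matrix (Fin n) (Fin n) ℝ := hA.eigenvectorUnitary
  have hV : V ∈ Matrix.orthogonalGroup (Fin n) ℝ := hA.eigenvectorUnitary.2
  have hspec : A = V * diagonal hA.eigenvalues * Vᵀ := hA.spectral_theorem
  have hVV : Vᵀ * V = 1 := (mem_orthogonalGroup_iff' _ _).1 hV
  have hconj : ∀ U : Matrix (Fin n) (Fin n) ℝ,
      U * A * Uᵀ = U * V * diagonal hA.eigenvalues * (U * V)ᵀ := fun U => by
    conv_lhs => rw [hspec]
    simp only [transpose_mul, Matrix.mul_assoc]
  have hdiag : ∀ U ∈ Matrix.orthogonalGroup (Fin n) ℝ, (U * A * Uᵀ).diag ∈ hypCone P 1 ∧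
      MvPolynomial.eval hA.eigenvalues P ≤ MvPolynomial.eval (U * A * Uᵀ).diag P := by
    intro U hU
    rw [hconj, diag_mul_diagonal_mul_transpose]
    exact hhyp.le_eval_mulVec hsymm hmem (hadamard_self_mem_doublyStochastic (mul_mem hU hV))
  refine ⟨fun U hU => ⟨(hdiag U hU).2, ?_⟩, fun U hU hD => le_antisymm ?_ (hdiag U hU).2,
    Vᵀ, Unitary.star_mem hV, ?_⟩
  · rcases Nat.eq_zero_or_pos n with rfl | hn
    · rw [Subsingleton.elim (U * A * Uᵀ).diag]
    · have hn' : (n : ℝ) ≠ 0 := by exact_mod_cast hn.ne'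
      -- The averaging matrix replaces every diagonal entry by their mean, which is the trace over
      -- `n`.
      have hM : (Matrix.of fun _ _ => (n : ℝ)⁻¹ : Matrix (Fin n) (Fin n) ℝ) ∈
          doublyStochastic ℝ (Fin n) := by
        rw [mem_doublyStochastic_iff_sum]
        exact ⟨fun _ _ => by rw [of_apply]; positivity, fun _ => by simp [hn'],
          fun _ => by simp [hn']⟩
      have htr : A.trace = (U * A * Uᵀ).trace := by
        rw [trace_mul_comm, ← Matrix.mul_assoc, (mem_orthogonalGroup_iff' _ _).1 hU,
          Matrix.one_mul]
      have hmean : (A.trace / (n : ℝ)) • (1 : Fin n → ℝ) =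
          (Matrix.of fun _ _ => (n : ℝ)⁻¹ : Matrix (Fin n) (Fin n) ℝ) *ᵥ (U * A * Uᵀ).diag := by
        funext i
        rw [htr, trace]
        simp [mulVec, dotProduct, ← Finset.mul_sum, div_eq_inv_mul]
      rw [hmean]
      exact (hhyp.le_eval_mulVec hsymm (hdiag U hU).1 hM).2
  · have hW := mul_mem hU hV
    have hWt : (U * V)ᵀ ∈ Matrix.orthogonalGroup (Fin n) ℝ := Unitary.star_mem hW
    have hWW : (U * V)ᵀ * (U * V) = 1 := (mem_orthogonalGroup_iff' _ _).1 hW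
    -- When `UAUᵀ` is diagonal, conjugating back shows that the eigenvalues are in turn a doubly
    -- stochastic image of its diagonal, which reverses the inequality.
    have heig : hA.eigenvalues =
        ((U * V)ᵀ ⊙ (U * V)ᵀ) *ᵥ (U * A * Uᵀ).diag := by
      rw [← diag_mul_diagonal_mul_transpose, hD.diagonal_diag, hconj, transpose_transpose]
      have : (U * V)ᵀ * (U * V * diagonal hA.eigenvalues * (U * V)ᵀ) * (U * V) =
          ((U * V)ᵀ * (U * V)) * diagonal hA.eigenvalues * ((U * V)ᵀ * (U * V)) := by
        simp only [Matrix.mul_assoc]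
      rw [this, hWW, Matrix.one_mul, Matrix.mul_one, diag_diagonal]
    conv_rhs => rw [heig]
    exact (hhyp.le_eval_mulVec hsymm (hdiag U hU).1
      (hadamard_self_mem_doublyStochastic hWt)).2
  · rw [hconj, hVV, Matrix.one_mul, transpose_one, Matrix.mul_one]
    exact isDiag_diagonal _
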